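/- Let $X=[0,1)$, let $\mathfrak S_{\mathrm{fin}}$ be the group of finitely supported permutations of $X$, and let $\mathfrak A_{\mathrm{fin}}$ be the kernel of the classical signature $\varepsilon_{\mathrm{fin}}:\mathfrak S_{\mathrm{fin}}\to\mathbb Z/2\mathbb Z$. Let $\widehat{\mathrm{PC}^{\bowtie}}$ be the group of all permutations of $X$ that are continuous outside a finite set, and let $\mathrm{PC}^{\bowtie}=\widehat{\mathrm{PC}^{\bowtie}}/\mathfrak S_{\mathrm{fin}}$. For $h\in\widehat{\mathrm{PC}^{\bowtie}}$, let $I_1,\dots,I_n$ be the partition of $X$ into the minimal number of left-closed right-open intervals such that $h$ is continuous on the interior $I_j^\circ$ of each $I_j$ in $\mathbb R$. Let $\alpha_j$ and $\beta_j$ be the left endpoints of $I_j$ and of $h(I_j^\circ)$, let $\sigma_h\in\mathfrak S_{\mathrm{fin}}$ be the permutation that sends $h(\alpha_j)$ to $\beta_j$ for every $j$ and fixes all other points, and let $R(h)$ be the number of $j$ such that $h$ is order-reversing on $I_j^\circ$. Put $\varepsilon(h)=R(h)+\varepsilon_{\mathrm{fin}}(\sigma_h)\in\mathbb Z/2\mathbb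 Z$. Let $\widehat G$ be a subgroup of $\widehat{\mathrm{PC}^{\bowtie}}$ containing $\mathfrak S_{\mathrm{fin}}$ whose projection $G$ to $\mathrm{PC}^{\bowtie}$ is simple and nonabelian, and suppose that $\widehat G\smallsetminus\mathfrak A_{\mathrm{fin}}$ contains an element of order $3$. Then $\varepsilon:\widehat{\mathrm{PC}^{\bowtie}}\to\mathbb Z/2\mathbb Z$ is a group homomorphism and $$J_3(\widehat G)=\operatorname{Ker}(\varepsilon|_{\widehat G})=D(\widehat G),$$ where $J_3(\widehat G)$ is the subgroup of $\widehat G$ generated by the elements of order $3$ and $D(\widehat G)$ is the derived subgroup of $\widehat G$. -/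

import Mathlib

open Set Topology

noncomputable section

namespace PCSig

/-! ### Finitely supported permutations and their signature -/

section Finitary

variable {α : Type*}

/-- The subgroup of all finitely supported permutations of a set. -/
def SFin (α : Type*) : Subgroup (Equiv.Perm α) where
  carrier := {σ | {x | σ x ≠ x}.Finite}
  one_mem' := by simp
  mul_mem' := by
    intro a b ha hb
    refine (ha.union hb).subset ?_
    intro x hx
    by_contra h
    simp only [mem_union, mem_ofPred_eq, not_or, not_not] at h
    exact hx (by rw [Equiv.Perm.mul_apply, h.2, h.1])
  inv_mem' := by
    intro a ha
    refine Set.Finite.subset ha ?_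
    intro x hx h
    exact hx (by rw [Equiv.Perm.inv_eq_iff_eq, h])

instance SFin_normal : (SFin α).Normal where
  conj_mem := by
    intro σ hσ g
    have hσ' : {x | σ x ≠ x}.Finite := hσ
    refine (hσ'.image g).subset ?_
    intro x hx
    refine ⟨g⁻¹ x, ?_, by simp⟩
    intro h
    apply hx
    rw [Equiv.Perm.mul_apply, Equiv.Perm.mul_apply, h, ← Equiv.Perm.mul_apply, mul_inv_cancel,
      Equiv.Perm.one_apply]

/-- The restriction of a permutation to its support. -/
def restrictSupport (σ : Equiv.Perm α) : Equiv.Perm {x // σ x ≠ x} :=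
  σ.subtypePerm (fun _ => not_congr σ.injective.eq_iff)

open Classical in
/-- The classical signature of a finitely supported permutation: the signature of its
restriction to its (finite) support. -/
def finSignFun (σ : SFin α) : ℤˣ :=
  letI : Fintype {x // σ.1 x ≠ x} := Set.Finite.fintype σ.2
  Equiv.Perm.sign (restrictSupport σ.1)

open Classical in
theorem finSignFun_eq (σ : SFin α) (s : Finset α) (hs : ∀ x, σ.1 x ≠ x → x ∈ s)
    (h : ∀ x, σ.1 x ∈ s ↔ x ∈ s) :
    finSignFun σ = Equiv.Perm.sign (σ.1.subtypePerm h) := by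
  let _ : Fintype {x // σ.1 x ≠ x} := Set.Finite.fintype σ.2
  unfold finSignFun
  refine Equiv.Perm.sign_bij (fun x _ => ⟨x.1, hs x.1 x.2⟩) ?_ ?_ ?_
  · intro x hx hx'
    rfl
  · intro x y _ _ hxy
    exact Subtype.ext (by simpa using hxy)
  · intro y hy
    have hy' : σ.1 y.1 ≠ y.1 := fun h' => hy (Subtype.ext h')
    refine ⟨⟨y.1, hy'⟩, ?_, rfl⟩
    intro h'
    exact hy' (congrArg Subtype.val h')

theorem mem_iff_of_support {σ : Equiv.Perm α} {s : Finset α} (hs : ∀ x, σ x ≠ x → x ∈ s) (x : α) :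
    σ x ∈ s ↔ x ∈ s := by
  by_cases hx : σ x = x
  · rw [hx]
  · exact ⟨fun _ => hs x hx, fun _ => hs _ (fun h => hx (σ.injective h))⟩

/-- The classical signature on the group of finitely supported permutations. -/
def finSign : SFin α →* ℤˣ where
  toFun := finSignFun
  map_one' := by
    classical
    rw [finSignFun_eq (1 : SFin α) ∅ (by simp) (by simp)]
    have : Equiv.Perm.subtypePerm (1 : Equiv.Perm α)
        (p := fun x => x ∈ (∅ : Finset α)) (by simp) = 1 := by
      ext x; rfl
    exact (congrArg Equiv.Perm.sign this).trans Equiv.Perm.sign_one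
  map_mul' := by
    classical
    intro a b
    have ha : {x | a.1 x ≠ x}.Finite := a.2
    have hb : {x | b.1 x ≠ x}.Finite := b.2
    let s : Finset α := ha.toFinset ∪ hb.toFinset
    have hsa : ∀ x, a.1 x ≠ x → x ∈ s := fun x hx => by simp [s, hx]
    have hsb : ∀ x, b.1 x ≠ x → x ∈ s := fun x hx => by simp [s, hx]
    have hsab : ∀ x, (a * b).1 x ≠ x → x ∈ s := by
      intro x hx
      by_contra h
      have h1 : b.1 x = x := by by_contra h'; exact h (hsb x h')
      have h2 : a.1 x = x := by by_contra h'; exact h (hsa x h')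
      exact hx (by
        change a.1 (b.1 x) = x
        rw [h1, h2])
    rw [finSignFun_eq a s hsa (mem_iff_of_support hsa),
      finSignFun_eq b s hsb (mem_iff_of_support hsb),
      finSignFun_eq (a * b) s hsab (mem_iff_of_support hsab), ← Equiv.Perm.sign_mul]
    rfl

/-- The classical signature, with values in the additive group `ℤ/2ℤ`. -/
def epsFin (σ : SFin α) : ZMod 2 := if finSign σ = 1 then 0 else 1

/-- The subgroup of even finitely supported permutations: the kernel of the signature. -/
def AFin (α : Type*) : Subgroup (Equiv.Perm α) := (finSign (α := α)).ker.map (SFin α).subtype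

end Finitary

/-! ### The group of piecewise continuous permutations of `[0,1)` -/

/-- The interval `[0,1)`. -/
abbrev X : Type := Set.Ico (0 : ℝ) 1

/-- The left endpoint of `[0,1)`. -/
def zero : X := ⟨0, by norm_num⟩

/-- An injective map which is continuous on an open subset of `(0,1)` is open there. -/
theorem isOpen_image {h : X → X} (hinj : Function.Injective h) {U : Set X} (hU : IsOpen U)
    (h0 : zero ∉ U) (hc : ContinuousOn h U) :
    IsOpen (Subtype.val '' (h '' U) : Set ℝ) := by
  rw [isOpen_iff_mem_nhds]
  rintro _ ⟨_, ⟨x, hx, rfl⟩, rfl⟩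
  have hx0 : 0 < x.1 := by
    rcases lt_or_eq_of_le x.2.1 with h' | h'
    · exact h'
    · exact absurd (show zero ∈ U by
        have : zero = x := Subtype.ext h'
        rwa [this]) h0
  have hx1 : x.1 < 1 := x.2.2
  obtain ⟨V, hV, rfl⟩ := isOpen_induced_iff.1 hU
  have hVx : V ∩ Ioo 0 1 ∈ 𝓝 x.1 := (hV.inter isOpen_Ioo).mem_nhds ⟨hx, hx0, hx1⟩
  obtain ⟨c, d, hcx, hsub⟩ := (mem_nhds_iff_exists_Ioo_subset).1 hVx
  obtain ⟨c', hc1, hc2⟩ := exists_between hcx.1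
  obtain ⟨d', hd1, hd2⟩ := exists_between hcx.2
  have hI : ∀ t ∈ Icc c' d', t ∈ V ∧ 0 < t ∧ t < 1 := fun t ht => by
    have := hsub ⟨hc1.trans_le ht.1, ht.2.trans_lt hd2⟩
    exact ⟨this.1, this.2.1, this.2.2⟩
  -- the map in real coordinates
  let e : ℝ → ℝ := fun t => if ht : 0 ≤ t ∧ t < 1 then (h ⟨t, ht⟩).1 else 0
  have he : ∀ t (ht : t ∈ Icc c' d'), e t = (h ⟨t, (hI t ht).2.1.le, (hI t ht).2.2⟩).1 :=
    fun t ht => dif_pos ⟨(hI t ht).2.1.le, (hI t ht).2.2⟩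
  have hec : ContinuousOn e (Icc c' d') := by
    rw [continuousOn_iff_continuous_domRestrict]
    have hk : Continuous fun t : Icc c' d' =>
        (⟨t.1, (hI t.1 t.2).2.1.le, (hI t.1 t.2).2.2⟩ : X) :=
      Continuous.subtype_mk continuous_subtype_val _
    have := continuous_subtype_val.comp (hc.comp_continuous hk (fun t => (hI t.1 t.2).1))
    convert this using 1
    ext t
    exact he t.1 t.2
  have hei : InjOn e (Icc c' d') := by
    intro s hs t ht hst
    rw [he s hs, he t ht] at hst
    exact congrArg Subtype.val (hinj (Subtype.ext hst))
  have hxm : x.1 ∈ Icc c' d' := ⟨hc2.le, hd1.le⟩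
  have hcd : c' ≤ d' := (hc2.trans hd1).le
  have hcm : c' ∈ Icc c' d' := left_mem_Icc.2 hcd
  have hdm : d' ∈ Icc c' d' := right_mem_Icc.2 hcd
  have hex : e x.1 = (h x).1 := he x.1 hxm
  have himg : e '' Icc c' d' ⊆ Subtype.val '' (h '' (Subtype.val ⁻¹' V)) := by
    rintro _ ⟨t, ht, rfl⟩
    exact ⟨_, ⟨⟨t, (hI t ht).2.1.le, (hI t ht).2.2⟩, (hI t ht).1, rfl⟩, (he t ht).symm⟩
  rcases hec.strictMonoOn_of_injOn_Icc' hcd hei with hm | hm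
  · refine Filter.mem_of_superset ?_ ((intermediate_value_Icc hcd hec).trans himg)
    rw [← hex]
    exact Icc_mem_nhds (hm hcm hxm hc2) (hm hxm hdm hd1)
  · refine Filter.mem_of_superset ?_ ((intermediate_value_Icc' hcd hec).trans himg)
    rw [← hex]
    exact Icc_mem_nhds (hm hxm hdm hd1) (hm hcm hxm hc2)

/-- The set of points of `[0,1)` at which a self-map of `[0,1)` is not continuous. -/
def discontinuities (h : X → X) : Set X := {x | ¬ ContinuousAt h x}

theorem discontinuities_symm_subset (h : Equiv.Perm X) (hf : (discontinuities h).Finite) :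
    discontinuities h.symm ⊆ h '' insert zero (discontinuities h) := by
  intro y hy
  by_contra hn
  apply hy
  have hx : h.symm y ∉ insert zero (discontinuities h) := fun hx => hn ⟨_, hx, by simp⟩
  have hfin : (insert zero (discontinuities h)).Finite := hf.insert _
  rw [ContinuousAt, (nhds_basis_opens _).tendsto_right_iff]
  rintro W ⟨hW1, hW2⟩
  let U : Set X := W ∩ (insert zero (discontinuities h))ᶜ
  have hU : IsOpen U := hW2.inter hfin.isClosed.isOpen_compl
  have hc : ContinuousOn h U := by
    intro x hxU
    have : ContinuousAt h x := by
      by_contra h'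
      exact hxU.2 (mem_insert_of_mem _ h')
    exact this.continuousWithinAt
  have ho := isOpen_image h.injective hU (fun h0 => h0.2 (mem_insert _ _)) hc
  have ho' : IsOpen (h '' U) := by
    rw [← preimage_image_eq (h '' U) Subtype.val_injective]
    exact ho.preimage continuous_subtype_val
  filter_upwards [ho'.mem_nhds ⟨h.symm y, ⟨hW1, hx⟩, by simp⟩]
  rintro _ ⟨x, hxU, rfl⟩
  simpa using hxU.1

/-- The group of all permutations of `[0,1)` which are continuous outside a finite set. -/
def PCHat : Subgroup (Equiv.Perm X) where
  carrier := {h | (discontinuities h).Finite}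
  one_mem' := by
    have : discontinuities (1 : Equiv.Perm X) = ∅ := by
      ext x
      simpa [discontinuities] using (continuous_id (X := X)).continuousAt
    change (discontinuities (1 : Equiv.Perm X)).Finite
    rw [this]
    exact Set.finite_empty
  mul_mem' := by
    intro a b ha hb
    have ha' : (discontinuities a).Finite := ha
    have hb' : (discontinuities b).Finite := hb
    refine (hb'.union (ha'.preimage (b.injective.injOn))).subset ?_
    intro x hx
    by_contra hn
    simp only [discontinuities, mem_union, mem_preimage, mem_ofPred_eq, not_or, not_not] at hn
    exact hx (ContinuousAt.comp (g := a) (f := b) hn.2 hn.1)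
  inv_mem' := by
    intro a ha
    have ha' : (discontinuities a).Finite := ha
    exact ((ha'.insert zero).image a).subset (discontinuities_symm_subset a ha')

theorem SFin_le_PCHat : SFin X ≤ PCHat := by
  intro σ hσ
  have hσ' : {x | σ x ≠ x}.Finite := hσ
  refine hσ'.subset ?_
  intro x hx
  by_contra hxs
  apply hx
  refine (continuousAt_id (x := x)).congr ?_
  filter_upwards [hσ'.isClosed.isOpen_compl.mem_nhds hxs] with y hy
  exact (not_not.1 hy).symm

/-- The finitely supported permutations, as a subgroup of `PCHat`. -/
abbrev SFinPC : Subgroup PCHat := (SFin X).subgroupOf PCHat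

/-- The even finitely supported permutations, as a subgroup of `PCHat`. -/
abbrev AFinPC : Subgroup PCHat := (AFin X).subgroupOf PCHat

/-- The group `PC`: the quotient of `PCHat` by the finitely supported permutations. -/
abbrev PC : Type := PCHat ⧸ SFinPC

/-! ### Partitions into intervals and the signature on `PCHat`

A finite partition of `[0,1)` into left-closed right-open intervals is encoded by the finite set
`S` of the left endpoints of its intervals; such sets are exactly the finite sets containing `0`.
-/

/-- The interior of the interval with left endpoint `a` in the partition with set of left
endpoints `S`: the points strictly between `a` and the next element of `S` (or `1`). -/
def cell (S : Finset X) (a : X) : Set X := {x | a < x ∧ ∀ s ∈ S, a < s → x < s}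

/-- `S` is the set of left endpoints of a partition into intervals associated with `h`: `h` is
continuous on the interior of each interval. -/
structure IsAssociated (h : Equiv.Perm X) (S : Finset X) : Prop where
  zero_mem : zero ∈ S
  cont : ∀ a ∈ S, ContinuousOn h (cell S a)

theorem cell_isOpen (S : Finset X) (a : X) : IsOpen (cell S a) := by
  have : cell S a = Ioi a ∩ ⋂ s ∈ S.filter (fun s => a < s), Iio s := by
    ext x
    simp [cell]
  rw [this]
  exact isOpen_Ioi.inter (isOpen_biInter_finset fun _ _ => isOpen_Iio)

theorem zero_le (x : X) : zero ≤ x := x.2.1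

theorem zero_notMem_cell (S : Finset X) (a : X) : zero ∉ cell S a :=
  fun h => absurd (zero_le a) (not_le.2 h.1)

theorem cell_ordConnected (S : Finset X) (a : X) : OrdConnected (cell S a) :=
  ⟨fun _ hx _ hy _ hz => ⟨hx.1.trans_le hz.1, fun s hs has => hz.2.trans_lt (hy.2 s hs has)⟩⟩

theorem exists_gt_of_finite (T : Finset X) (a : X) (hT : ∀ s ∈ T, a < s) :
    ∃ x, a < x ∧ ∀ s ∈ T, x < s := by
  induction T using Finset.induction_on with
  | empty =>
    obtain ⟨t, h1, h2⟩ := exists_between a.2.2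
    exact ⟨⟨t, a.2.1.trans h1.le, h2⟩, h1, by simp⟩
  | insert b T _ ih =>
    obtain ⟨x, hx, hxT⟩ := ih fun s hs => hT s (Finset.mem_insert_of_mem hs)
    have hab : a.1 < b.1 := hT b (Finset.mem_insert_self _ _)
    have hax : a.1 < x.1 := hx
    obtain ⟨t, h1, h2⟩ := exists_between (lt_min hab hax)
    have htb : t < b.1 := h2.trans_le (min_le_left _ _)
    have htx : t < x.1 := h2.trans_le (min_le_right _ _)
    refine ⟨⟨t, a.2.1.trans h1.le, htb.trans b.2.2⟩, h1, ?_⟩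
    intro s hs
    rcases Finset.mem_insert.1 hs with rfl | hs
    · exact htb
    · exact lt_trans (show (⟨t, _⟩ : X) < x from htx) (hxT s hs)

theorem cell_nonempty (S : Finset X) (a : X) : (cell S a).Nonempty := by
  obtain ⟨x, h1, h2⟩ := exists_gt_of_finite (S.filter (fun s => a < s)) a (by simp)
  exact ⟨x, h1, fun s hs has => h2 s (Finset.mem_filter.2 ⟨hs, has⟩)⟩

theorem exists_mem_cell {S : Finset X} (h0 : zero ∈ S) {x : X} (hx : x ∉ S) :
    ∃ a ∈ S, x ∈ cell S a := by
  have hne : (S.filter (fun s => s < x)).Nonempty := by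
    refine ⟨zero, Finset.mem_filter.2 ⟨h0, lt_of_le_of_ne (zero_le x) ?_⟩⟩
    rintro rfl
    exact hx h0
  obtain ⟨ha, ha'⟩ := Finset.mem_filter.1 (Finset.max'_mem _ hne)
  refine ⟨_, ha, ha', fun s hs has => ?_⟩
  by_contra hsx
  have hlt : s < x := lt_of_le_of_ne (not_lt.1 hsx) (by rintro rfl; exact hx hs)
  exact absurd (Finset.le_max' _ s (Finset.mem_filter.2 ⟨hs, hlt⟩)) (not_le.2 has)

theorem cell_disjoint {S : Finset X} {a b : X} (ha : a ∈ S) (hb : b ∈ S) {x : X}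
    (hxa : x ∈ cell S a) (hxb : x ∈ cell S b) : a = b := by
  rcases lt_trichotomy a b with h | h | h
  · exact absurd (hxa.2 b hb h) (not_lt.2 hxb.1.le)
  · exact h
  · exact absurd (hxb.2 a ha h) (not_lt.2 hxa.1.le)

/-- The image of `cell S a` under `h`, as a set of real numbers. -/
def imageCell (h : Equiv.Perm X) (S : Finset X) (a : X) : Set ℝ := Subtype.val '' (h '' cell S a)

theorem imageCell_subset (h : Equiv.Perm X) (S : Finset X) (a : X) :
    imageCell h S a ⊆ Ico 0 1 := by
  rintro _ ⟨y, _, rfl⟩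
  exact y.2

theorem imageCell_nonempty (h : Equiv.Perm X) (S : Finset X) (a : X) :
    (imageCell h S a).Nonempty := ((cell_nonempty S a).image _).image _

theorem imageCell_bddBelow (h : Equiv.Perm X) (S : Finset X) (a : X) :
    BddBelow (imageCell h S a) := ⟨0, fun _ hy => (imageCell_subset h S a hy).1⟩

/-- The left endpoint of the interval `h(cell S a)`. -/
def leftEnd (h : Equiv.Perm X) (S : Finset X) (a : X) : X :=
  ⟨sInf (imageCell h S a), by
    obtain ⟨y, hy⟩ := imageCell_nonempty h S a
    refine ⟨le_csInf ⟨y, hy⟩ fun z hz => (imageCell_subset h S a hz).1, ?_⟩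
    exact (csInf_le (imageCell_bddBelow h S a) hy).trans_lt (imageCell_subset h S a hy).2⟩

theorem imageCell_isOpen {h : Equiv.Perm X} {S : Finset X} (hS : IsAssociated h S) {a : X}
    (ha : a ∈ S) : IsOpen (imageCell h S a) :=
  isOpen_image h.injective (cell_isOpen S a) (zero_notMem_cell S a) (hS.cont a ha)

theorem imageCell_disjoint {h : Equiv.Perm X} {S : Finset X} {a b : X} (ha : a ∈ S) (hb : b ∈ S)
    {y : ℝ} (hya : y ∈ imageCell h S a) (hyb : y ∈ imageCell h S b) : a = b := by
  obtain ⟨_, ⟨x, hx, rfl⟩, rfl⟩ := hya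
  obtain ⟨_, ⟨x', hx', rfl⟩, he⟩ := hyb
  have : x' = x := h.injective (Subtype.ext he)
  subst this
  exact cell_disjoint ha hb hx hx'

theorem cell_isPreconnected (S : Finset X) (a : X) : IsPreconnected (cell S a) := by
  have : OrdConnected (Subtype.val '' cell S a : Set ℝ) := by
    refine ⟨?_⟩
    rintro _ ⟨x, hx, rfl⟩ _ ⟨y, hy, rfl⟩ z hz
    have hzX : z ∈ Ico (0 : ℝ) 1 := ⟨x.2.1.trans hz.1, hz.2.trans_lt y.2.2⟩
    exact ⟨⟨z, hzX⟩, (cell_ordConnected S a).out hx hy ⟨hz.1, hz.2⟩, rfl⟩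
  exact (Topology.IsInducing.subtypeVal.isPreconnected_image).1 this.isPreconnected

theorem imageCell_ordConnected {h : Equiv.Perm X} {S : Finset X} (hS : IsAssociated h S) {a : X}
    (ha : a ∈ S) : OrdConnected (imageCell h S a) :=
  (((cell_isPreconnected S a).image h (hS.cont a ha)).image _
    continuous_subtype_val.continuousOn).ordConnected

theorem leftEnd_lt {h : Equiv.Perm X} {S : Finset X} (hS : IsAssociated h S) {a : X}
    (ha : a ∈ S) {y : ℝ} (hy : y ∈ imageCell h S a) : (leftEnd h S a).1 < y := by
  obtain ⟨c, d, hcd, hsub⟩ :=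
    mem_nhds_iff_exists_Ioo_subset.1 ((imageCell_isOpen hS ha).mem_nhds hy)
  obtain ⟨t, ht1, ht2⟩ := exists_between hcd.1
  exact (csInf_le (imageCell_bddBelow h S a) (hsub ⟨ht1, ht2.trans hcd.2⟩)).trans_lt ht2

theorem leftEnd_mem {h : Equiv.Perm X} {S : Finset X} (hS : IsAssociated h S) {a : X}
    (ha : a ∈ S) : ∃ b ∈ S, h b = leftEnd h S a := by
  refine ⟨h.symm (leftEnd h S a), ?_, by simp⟩
  by_contra hn
  obtain ⟨b, hb, hxb⟩ := exists_mem_cell hS.zero_mem hn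
  have hy : (leftEnd h S a).1 ∈ imageCell h S b := ⟨_, ⟨_, hxb, rfl⟩, by simp⟩
  have hcl : (leftEnd h S a).1 ∈ closure (imageCell h S a) :=
    csInf_mem_closure (imageCell_nonempty h S a) (imageCell_bddBelow h S a)
  obtain ⟨z, hzb, hza⟩ := mem_closure_iff.1 hcl _ (imageCell_isOpen hS hb) hy
  obtain rfl := imageCell_disjoint ha hb hza hzb
  exact lt_irrefl _ (leftEnd_lt hS hb hy)

theorem leftEnd_inj {h : Equiv.Perm X} {S : Finset X} (hS : IsAssociated h S) {a b : X}
    (ha : a ∈ S) (hb : b ∈ S) (hab : leftEnd h S a = leftEnd h S b) : a = b := by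
  have key : ∀ {a b : X}, a ∈ S → b ∈ S → leftEnd h S a = leftEnd h S b →
      ∀ y ∈ imageCell h S a, ∀ z ∈ imageCell h S b, y ≤ z → a = b := by
    intro a b ha hb hab y hy z hz hyz
    have h1 := leftEnd_lt hS ha hy
    rw [hab] at h1
    obtain ⟨w, hw, hwy⟩ := exists_lt_of_csInf_lt (imageCell_nonempty h S b) h1
    exact imageCell_disjoint ha hb hy ((imageCell_ordConnected hS hb).out hw hz ⟨hwy.le, hyz⟩)
  obtain ⟨y, hy⟩ := imageCell_nonempty h S a
  obtain ⟨z, hz⟩ := imageCell_nonempty h S b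
  rcases le_total y z with hyz | hyz
  · exact key ha hb hab y hy z hz hyz
  · exact (key hb ha hab.symm z hz y hy hyz).symm

/-- The map `h(a) ↦ leftEnd h S a` as a self-map of the finite set `h(S)`. -/
def defaultMap (h : Equiv.Perm X) (S : Finset X) (hS : IsAssociated h S)
    (y : {y : X // ∃ a ∈ S, h a = y}) : {y : X // ∃ a ∈ S, h a = y} :=
  ⟨leftEnd h S (h.symm y.1), leftEnd_mem hS (by
    obtain ⟨_, a, ha, rfl⟩ := y
    simpa using ha)⟩

instance finite_image_endpoints (h : Equiv.Perm X) (S : Finset X) :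
    Finite {y : X // ∃ a ∈ S, h a = y} :=
  (S.finite_toSet.image h).to_subtype

theorem defaultMap_bijective (h : Equiv.Perm X) (S : Finset X) (hS : IsAssociated h S) :
    Function.Bijective (defaultMap h S hS) := by
  refine Finite.injective_iff_bijective.1 ?_
  rintro ⟨_, a, ha, rfl⟩ ⟨_, b, hb, rfl⟩ hab
  have hab' := congrArg Subtype.val hab
  simp only [defaultMap, Equiv.symm_apply_apply] at hab'
  obtain rfl := leftEnd_inj hS ha hb hab'
  rfl

open Classical in
/-- The default of pseudo right continuity of `h` about the partition `S`: the permutation which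
sends `h(a)` to the left endpoint of `h(cell S a)` for each `a ∈ S` and fixes all other points. -/
def defaultPerm (h : Equiv.Perm X) (S : Finset X) (hS : IsAssociated h S) : SFin X :=
  ⟨Equiv.Perm.ofSubtype (Equiv.ofBijective _ (defaultMap_bijective h S hS)), by
    refine (S.finite_toSet.image h).subset ?_
    intro x hx
    by_contra hn
    exact hx (Equiv.Perm.ofSubtype_apply_of_not_mem _ hn)⟩

theorem defaultPerm_apply (h : Equiv.Perm X) (S : Finset X) (hS : IsAssociated h S) {a : X}
    (ha : a ∈ S) : (defaultPerm h S hS).1 (h a) = leftEnd h S a := by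
  classical
  have hd : (defaultPerm h S hS).1 =
      Equiv.Perm.ofSubtype (Equiv.ofBijective _ (defaultMap_bijective h S hS)) := by
    unfold defaultPerm
    congr
  rw [hd]
  have := Equiv.Perm.ofSubtype_apply_of_mem
    (Equiv.ofBijective _ (defaultMap_bijective h S hS)) (a := h a) ⟨a, ha, rfl⟩
  simp only [Equiv.ofBijective_apply, defaultMap, Equiv.symm_apply_apply] at this
  exact this

theorem defaultPerm_apply_of_notMem (h : Equiv.Perm X) (S : Finset X) (hS : IsAssociated h S)
    {y : X} (hy : ¬ ∃ a ∈ S, h a = y) : (defaultPerm h S hS).1 y = y := by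
  classical
  exact Equiv.Perm.ofSubtype_apply_of_not_mem _ hy

open Classical in
/-- The flip number of `h` about the partition `S`: the number of intervals on whose interior `h`
is order-reversing. -/
def flipNumber (h : Equiv.Perm X) (S : Finset X) : ℕ :=
  (S.filter fun a => StrictAntiOn h (cell S a)).card

/-- The signature of `h` computed with the partition `S`. -/
def epsilonAt (h : Equiv.Perm X) (S : Finset X) (hS : IsAssociated h S) : ZMod 2 :=
  (flipNumber h S : ZMod 2) + epsFin (defaultPerm h S hS)

open Classical in
/-- The left endpoints of the minimal partition associated with `h`: the point `0` together with
the points of discontinuity of `h`. -/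
def minPartition (h : PCHat) : Finset X :=
  insert zero (Set.Finite.toFinset (s := discontinuities h.1) h.2)

theorem minPartition_isAssociated (h : PCHat) : IsAssociated h.1 (minPartition h) where
  zero_mem := by simp [minPartition]
  cont := by
    intro a _ x hx
    refine ContinuousAt.continuousWithinAt ?_
    by_contra hc
    have hxS : x ∈ minPartition h := by
      exact Finset.mem_insert_of_mem ((Set.Finite.mem_toFinset _).2 hc)
    exact lt_irrefl x (hx.2 x hxS hx.1)

/-- Every partition associated with `h` refines the minimal one. -/
theorem minPartition_subset (h : PCHat) {S : Finset X} (hS : IsAssociated h.1 S) :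
    minPartition h ⊆ S := by
  intro x hx
  by_contra hxS
  rcases Finset.mem_insert.1 hx with rfl | hx
  · exact hxS hS.zero_mem
  · obtain ⟨a, ha, hxa⟩ := exists_mem_cell hS.zero_mem hxS
    exact (Set.Finite.mem_toFinset _).1 hx ((hS.cont a ha).continuousAt ((cell_isOpen S a).mem_nhds hxa))

/-- The signature on `PCHat`, computed with the minimal associated partition. -/
def epsilon (h : PCHat) : ZMod 2 := epsilonAt h.1 (minPartition h) (minPartition_isAssociated h)

/-- The subgroup of a group generated by its elements of order `3`. -/
def J3 (H : Type*) [Group H] : Subgroup H := Subgroup.closure {g : H | orderOf g = 3}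

end PCSig

end

noncomputable section

namespace PCSig

/-! ### The finitary signature -/

section Finitary

variable {α : Type*}

/-! The signature may be computed from any partition on whose open cells `h` is continuous. Cut a
cell with left endpoint `a` at an interior point `s`. If `h` increases there, neither the flip
number nor the default permutation changes. If `h` decreases, there is one more flip, and the
default permutation is multiplied by the transposition of `h a` and `h s`; the two changes cancel
mod 2 (`epsilonAt_insert`).

For a product `g * h`, choose a partition `S` for `h` fine enough that `T = h(S)` serves for `g`.
Then `h` carries cells of `S` to cells of `T`, flips add mod 2, and σ_{gh} = σ_g · (g σ_h g⁻¹).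
Since conjugation preserves the classical signature, `epsilon` is additive (`epsilonAt_mul`,
`epsilon_mul`). It agrees with the classical signature on finitely supported permutations, so its
kernel meets them in the alternating group.

The rest is group theory. Let `K` be `J3` or the derived subgroup. It is normal, lies in the kernel,
contains the alternating group, and has nontrivial image in the simple quotient, hence maps onto it.
So an element of the kernel is an element of `K` times an even finitely supported permutation, and
therefore lies in `K` (`eq_ker_of_isSimpleGroup`). -/

theorem finSign_eq_one_or (σ : SFin α) : finSign σ = 1 ∨ finSign σ = -1 :=
  Int.units_eq_one_or _

theorem epsFin_mul (σ τ : SFin α) : epsFin (σ * τ) = epsFin σ + epsFin τ := by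
  unfold epsFin
  rw [map_mul]
  rcases finSign_eq_one_or σ with h | h <;> rcases finSign_eq_one_or τ with h' | h' <;>
    rw [h, h'] <;> decide

theorem epsFin_eq_zero_iff (σ : SFin α) : epsFin σ = 0 ↔ finSign σ = 1 := by
  unfold epsFin
  split_ifs with h <;> simp [h]

theorem epsFin_eq_zero_iff_mem (σ : SFin α) : epsFin σ = 0 ↔ σ.1 ∈ AFin α := by
  rw [epsFin_eq_zero_iff]
  constructor
  · intro h
    exact ⟨σ, h, rfl⟩
  · rintro ⟨τ, hτ, h⟩
    obtain rfl : τ = σ := Subtype.ext h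
    exact hτ

/-- The map `g` carries the support of `σ` bijectively onto that of `τ` and intertwines the two. As
`g` may have infinite support, multiplicativity of `finSign` alone does not suffice. -/
theorem finSign_congr (g : Equiv.Perm α) {σ τ : SFin α} (h : τ.1 = g * σ.1 * g⁻¹) :
    finSign τ = finSign σ := by
  classical
  change finSignFun τ = finSignFun σ
  unfold finSignFun
  let _ : Fintype {x // σ.1 x ≠ x} := Set.Finite.fintype σ.2
  let _ : Fintype {x // τ.1 x ≠ x} := Set.Finite.fintype τ.2
  have hτ : ∀ x, τ.1 (g x) = g (σ.1 x) := fun x => by simp [h]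
  symm
  refine Equiv.Perm.sign_bij
    (fun x _ => ⟨g x.1, by rw [hτ]; exact fun e => x.2 (g.injective e)⟩) ?_ ?_ ?_
  · intro x _ _
    exact Subtype.ext (hτ x.1).symm
  · intro x y _ _ hxy
    exact Subtype.ext (g.injective (congrArg Subtype.val hxy))
  · intro y hy
    have hy' : σ.1 (g⁻¹ y.1) ≠ g⁻¹ y.1 := by
      intro e
      have := hτ (g⁻¹ y.1)
      rw [e] at this
      rw [show g (g⁻¹ y.1) = y.1 from g.apply_symm_apply _] at this
      exact y.2 this
    refine ⟨⟨g⁻¹ y.1, hy'⟩, ?_, Subtype.ext (by simp)⟩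
    intro e
    exact hy' (congrArg Subtype.val e)

theorem swap_mem_SFin [DecidableEq α] (x y : α) : Equiv.swap x y ∈ SFin α := by
  refine (Set.toFinite {x, y}).subset ?_
  intro z hz
  by_contra hn
  simp only [mem_insert_iff, mem_singleton_iff, not_or] at hn
  exact hz (Equiv.swap_apply_of_ne_of_ne hn.1 hn.2)

theorem finSign_swap [DecidableEq α] {x y : α} (hxy : x ≠ y) :
    finSign ⟨Equiv.swap x y, swap_mem_SFin x y⟩ = -1 := by
  classical
  have hs : ∀ z, Equiv.swap x y z ≠ z → z ∈ ({x, y} : Finset α) := by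
    intro z hz
    by_contra hn
    simp only [Finset.mem_insert, Finset.mem_singleton, not_or] at hn
    exact hz (Equiv.swap_apply_of_ne_of_ne hn.1 hn.2)
  refine (finSignFun_eq _ {x, y} hs (mem_iff_of_support hs)).trans ?_
  have : (Equiv.swap x y).subtypePerm (mem_iff_of_support hs) =
      Equiv.swap (⟨x, by simp⟩ : {z // z ∈ ({x, y} : Finset α)}) ⟨y, by simp⟩ := by
    ext z
    simp only [Equiv.Perm.subtypePerm_apply, Equiv.swap_apply_def, Subtype.ext_iff]
    split_ifs <;> rfl
  rw [this]
  convert Equiv.Perm.sign_swap (x := (⟨x, by simp⟩ : {z // z ∈ ({x, y} : Finset α)}))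
    (y := ⟨y, by simp⟩) fun e => hxy (congrArg Subtype.val e)

theorem epsFin_swap [DecidableEq α] {x y : α} (hxy : x ≠ y) :
    epsFin ⟨Equiv.swap x y, swap_mem_SFin x y⟩ = 1 := by
  unfold epsFin
  rw [finSign_swap hxy]
  decide

end Finitary

/-! ### Associated partitions -/

theorem notMem_of_mem_cell {S : Finset X} {a x : X} (hx : x ∈ cell S a) : x ∉ S :=
  fun hxS => lt_irrefl x (hx.2 x hxS hx.1)

/-- The cells are open and cover the complement of `S`. In this pointwise form, stability under
refinement and composition is immediate. -/
theorem isAssociated_iff {h : Equiv.Perm X} {S : Finset X} :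
    IsAssociated h S ↔ zero ∈ S ∧ ∀ x ∉ S, ContinuousAt h x := by
  constructor
  · intro hS
    refine ⟨hS.zero_mem, fun x hx => ?_⟩
    obtain ⟨a, ha, hxa⟩ := exists_mem_cell hS.zero_mem hx
    exact (hS.cont a ha).continuousAt ((cell_isOpen S a).mem_nhds hxa)
  · rintro ⟨h0, hc⟩
    exact ⟨h0, fun a _ x hx => (hc x (notMem_of_mem_cell hx)).continuousWithinAt⟩

theorem IsAssociated.mono {h : Equiv.Perm X} {S T : Finset X} (hS : IsAssociated h S)
    (hST : S ⊆ T) : IsAssociated h T :=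
  isAssociated_iff.2 ⟨hST hS.zero_mem, fun _ hx =>
    (isAssociated_iff.1 hS).2 _ fun hxS => hx (hST hxS)⟩

/-- Moves the real infimum defining `leftEnd` into the order of `X`; left endpoints are then
identified by uniqueness of greatest lower bounds. -/
theorem isGLB_leftEnd (h : Equiv.Perm X) (S : Finset X) (a : X) :
    IsGLB (h '' cell S a) (leftEnd h S a) := by
  have hg : IsGLB (imageCell h S a) (leftEnd h S a).1 :=
    isGLB_csInf (imageCell_nonempty h S a) (imageCell_bddBelow h S a)
  constructor
  · intro y hy
    exact hg.1 ⟨y, hy, rfl⟩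
  · intro c hc
    refine hg.2 ?_
    rintro _ ⟨y, hy, rfl⟩
    exact hc hy

theorem leftEnd_eq {h : Equiv.Perm X} {S : Finset X} {a b : X}
    (hb : IsGLB (h '' cell S a) b) : leftEnd h S a = b :=
  (isGLB_leftEnd h S a).unique hb

/-- A continuous injection on an interval is strictly monotone. -/
theorem strictMonoOn_or_strictAntiOn {h : Equiv.Perm X} {S : Finset X} (hS : IsAssociated h S)
    {a : X} (ha : a ∈ S) : StrictMonoOn h (cell S a) ∨ StrictAntiOn h (cell S a) := by
  have : Inhabited X := ⟨zero⟩
  have : OrdConnected (cell S a) := cell_ordConnected S a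
  have : Inhabited (cell S a) := ⟨⟨_, (cell_nonempty S a).choose_spec⟩⟩
  have : StrictMono ((cell S a).domRestrict h) ∨ StrictAnti ((cell S a).domRestrict h) :=
    Continuous.strictMono_of_inj (hS.cont a ha).domRestrict h.injective.injOn.injective
  exact this.imp strictMono_domRestrict.mp strictAntiOn_iff_strictAnti.mpr

theorem exists_lt_mem_cell (S : Finset X) (a : X) {x : X} (hx : x ∈ cell S a) :
    ∃ y ∈ cell S a, y < x := by
  obtain ⟨y, hy, hyx⟩ := exists_between hx.1
  exact ⟨y, ⟨hy, fun s hs has => hyx.trans (hx.2 s hs has)⟩, hyx⟩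

theorem exists_gt_mem_cell (S : Finset X) (a : X) {x : X} (hx : x ∈ cell S a) :
    ∃ y ∈ cell S a, x < y := by
  obtain ⟨y, hy, hyS⟩ := exists_gt_of_finite (S.filter (fun s => a < s)) x
    (fun s hs => hx.2 s (Finset.mem_filter.1 hs).1 (Finset.mem_filter.1 hs).2)
  exact ⟨y, ⟨hx.1.trans hy, fun s hs has => hyS s (Finset.mem_filter.2 ⟨hs, has⟩)⟩, hy⟩

theorem not_strictAntiOn_of_strictMonoOn {h : X → X} {S : Finset X} {a : X}
    (hm : StrictMonoOn h (cell S a)) : ¬ StrictAntiOn h (cell S a) := by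
  intro hn
  obtain ⟨x, hx⟩ := cell_nonempty S a
  obtain ⟨y, hy, hyx⟩ := exists_lt_mem_cell S a hx
  exact lt_asymm (hm hy hx hyx) (hn hy hx hyx)

theorem defaultPerm_eq {h : Equiv.Perm X} {S : Finset X} (hS : IsAssociated h S)
    {τ : Equiv.Perm X} (h1 : ∀ b ∈ S, τ (h b) = leftEnd h S b)
    (h2 : ∀ y, (¬ ∃ b ∈ S, h b = y) → τ y = y) : (defaultPerm h S hS).1 = τ := by
  ext y : 1
  by_cases hy : ∃ b ∈ S, h b = y
  · obtain ⟨b, hb, rfl⟩ := hy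
    rw [defaultPerm_apply h S hS hb, h1 b hb]
  · rw [defaultPerm_apply_of_notMem h S hS hy, h2 y hy]

open Classical in
theorem flipNumber_eq_sum (h : Equiv.Perm X) (S : Finset X) :
    (flipNumber h S : ZMod 2) = ∑ a ∈ S, if StrictAntiOn h (cell S a) then 1 else 0 :=
  Finset.natCast_card_filter _ _

/-! ### Adding a point to a partition -/

section Insert

variable {h : Equiv.Perm X} {S : Finset X} {a s : X}

theorem cell_insert_left [DecidableEq X] (hs : s ∈ cell S a) : cell (insert s S) a = cell S a ∩ Iio s := by
  ext x
  simp only [cell, Finset.mem_insert, forall_eq_or_imp, mem_inter_iff, mem_ofPred_eq, mem_Iio]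
  have := hs.1
  tauto

theorem cell_insert_self [DecidableEq X] (hs : s ∈ cell S a) : cell (insert s S) s = cell S a ∩ Ioi s := by
  ext x
  constructor
  · rintro ⟨h1, h2⟩
    exact ⟨⟨hs.1.trans h1, fun t ht hat => h2 t (Finset.mem_insert_of_mem ht) (hs.2 t ht hat)⟩, h1⟩
  · rintro ⟨h1, h2⟩
    refine ⟨h2, fun t ht hst => ?_⟩
    rcases Finset.mem_insert.1 ht with rfl | ht
    · exact absurd hst (lt_irrefl _)
    · exact h1.2 t ht (hs.1.trans hst)

theorem cell_insert_of_ne [DecidableEq X] (ha : a ∈ S) (hs : s ∈ cell S a) {b : X} (hb : b ∈ S) (hba : b ≠ a) :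
    cell (insert s S) b = cell S b := by
  ext x
  simp only [cell, Finset.mem_insert, forall_eq_or_imp, mem_ofPred_eq]
  refine and_congr_right fun hbx => ⟨fun hx => hx.2, fun hx => ⟨fun hbs => ?_, hx⟩⟩
  -- If `b < a`, the cell of `b` already stops at `a`, before `s`; if `a < b`, then `s < b` because
  -- `s` is in the cell of `a`.
  rcases lt_or_gt_of_ne hba with hlt | hlt
  · exact (hx a ha hlt).trans hs.1
  · exact absurd (hs.2 b hb hlt) (not_lt.2 hbs.le)

/-- When `h` increases, the left piece of a cut cell keeps the old infimum and the right piece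
acquires `h s`, by continuity at `s`. When `h` decreases, the two pieces exchange roles. -/
theorem isGLB_image_Iio_of_strictMonoOn (hm : StrictMonoOn h (cell S a)) (hs : s ∈ cell S a)
    {β : X} (hβ : IsGLB (h '' cell S a) β) : IsGLB (h '' (cell S a ∩ Iio s)) β := by
  refine ⟨lowerBounds_mono_set (image_mono inter_subset_left) hβ.1, fun c hc => hβ.2 ?_⟩
  rintro _ ⟨x, hx, rfl⟩
  rcases lt_or_ge x s with hxs | hxs
  · exact hc ⟨x, ⟨hx, hxs⟩, rfl⟩
  · obtain ⟨y, hy, hys⟩ := exists_lt_mem_cell S a hs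
    exact (hc ⟨y, ⟨hy, hys⟩, rfl⟩).trans (hm hy hx (hys.trans_le hxs)).le

theorem isGLB_image_Ioi_of_strictAntiOn (hm : StrictAntiOn h (cell S a)) (hs : s ∈ cell S a)
    {β : X} (hβ : IsGLB (h '' cell S a) β) : IsGLB (h '' (cell S a ∩ Ioi s)) β := by
  refine ⟨lowerBounds_mono_set (image_mono inter_subset_left) hβ.1, fun c hc => hβ.2 ?_⟩
  rintro _ ⟨x, hx, rfl⟩
  rcases lt_or_ge s x with hxs | hxs
  · exact hc ⟨x, ⟨hx, hxs⟩, rfl⟩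
  · obtain ⟨y, hy, hys⟩ := exists_gt_mem_cell S a hs
    exact (hc ⟨y, ⟨hy, hys⟩, rfl⟩).trans (hm hx hy (hxs.trans_lt hys)).le

theorem isGLB_image_Ioi_of_strictMonoOn (hm : StrictMonoOn h (cell S a)) (hs : s ∈ cell S a)
    (hc : ContinuousAt h s) : IsGLB (h '' (cell S a ∩ Ioi s)) (h s) := by
  constructor
  · rintro _ ⟨x, ⟨hx, hsx⟩, rfl⟩
    exact (hm hs hx hsx).le
  · intro c hc'
    obtain ⟨y, _, hy⟩ := exists_gt_mem_cell S a hs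
    have : (𝓝[>] s).NeBot := nhdsGT_neBot_of_exists_gt ⟨y, hy⟩
    refine ge_of_tendsto (hc.tendsto.mono_left nhdsWithin_le_nhds : Filter.Tendsto h (𝓝[>] s) _) ?_
    filter_upwards [nhdsWithin_le_nhds ((cell_isOpen S a).mem_nhds hs), self_mem_nhdsWithin]
      with x hx hsx
    exact hc' ⟨x, ⟨hx, hsx⟩, rfl⟩

theorem isGLB_image_Iio_of_strictAntiOn (hm : StrictAntiOn h (cell S a)) (hs : s ∈ cell S a)
    (hc : ContinuousAt h s) : IsGLB (h '' (cell S a ∩ Iio s)) (h s) := by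
  constructor
  · rintro _ ⟨x, ⟨hx, hsx⟩, rfl⟩
    exact (hm hx hs hsx).le
  · intro c hc'
    obtain ⟨y, _, hy⟩ := exists_lt_mem_cell S a hs
    have : (𝓝[<] s).NeBot := nhdsLT_neBot_of_exists_lt ⟨y, hy⟩
    refine ge_of_tendsto (hc.tendsto.mono_left nhdsWithin_le_nhds : Filter.Tendsto h (𝓝[<] s) _) ?_
    filter_upwards [nhdsWithin_le_nhds ((cell_isOpen S a).mem_nhds hs), self_mem_nhdsWithin]
      with x hx hsx
    exact hc' ⟨x, ⟨hx, hsx⟩, rfl⟩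

theorem leftEnd_insert_of_ne [DecidableEq X] (ha : a ∈ S) (hs : s ∈ cell S a) {b : X} (hb : b ∈ S)
    (hba : b ≠ a) : leftEnd h (insert s S) b = leftEnd h S b :=
  leftEnd_eq (by rw [cell_insert_of_ne ha hs hb hba]; exact isGLB_leftEnd h S b)

theorem flipNumber_insert_of_strictMonoOn [DecidableEq X] (ha : a ∈ S) (hs : s ∈ cell S a)
    (hm : StrictMonoOn h (cell S a)) :
    (flipNumber h (insert s S) : ZMod 2) = flipNumber h S := by
  rw [flipNumber_eq_sum, flipNumber_eq_sum, Finset.sum_insert (notMem_of_mem_cell hs), if_neg,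
    zero_add]
  · refine Finset.sum_congr rfl fun b hb => ?_
    by_cases hba : b = a
    · subst hba
      rw [if_neg (not_strictAntiOn_of_strictMonoOn hm), if_neg]
      apply not_strictAntiOn_of_strictMonoOn
      rw [cell_insert_left hs]
      exact hm.mono inter_subset_left
    · rw [cell_insert_of_ne ha hs hb hba]
  · apply not_strictAntiOn_of_strictMonoOn
    rw [cell_insert_self hs]
    exact hm.mono inter_subset_left

theorem flipNumber_insert_of_strictAntiOn [DecidableEq X] (ha : a ∈ S) (hs : s ∈ cell S a)
    (hm : StrictAntiOn h (cell S a)) :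
    (flipNumber h (insert s S) : ZMod 2) = 1 + flipNumber h S := by
  rw [flipNumber_eq_sum, flipNumber_eq_sum, Finset.sum_insert (notMem_of_mem_cell hs), if_pos]
  · congr 1
    refine Finset.sum_congr rfl fun b hb => ?_
    by_cases hba : b = a
    · subst hba
      rw [if_pos hm, if_pos]
      rw [cell_insert_left hs]
      exact hm.mono inter_subset_left
    · rw [cell_insert_of_ne ha hs hb hba]
  · rw [cell_insert_self hs]
    exact hm.mono inter_subset_left

theorem epsilonAt_insert [DecidableEq X] (hS : IsAssociated h S) (hS' : IsAssociated h (insert s S)) :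
    epsilonAt h (insert s S) hS' = epsilonAt h S hS := by
  by_cases hsS : s ∈ S
  · simp only [Finset.insert_eq_self.2 hsS]
  obtain ⟨a, ha, hs⟩ := exists_mem_cell hS.zero_mem hsS
  have hc : ContinuousAt h s := (isAssociated_iff.1 hS).2 s hsS
  have hhs : ¬ ∃ b ∈ S, h b = h s := by
    rintro ⟨b, hb, he⟩
    exact hsS (h.injective he ▸ hb)
  have hnot : ∀ y, (¬ ∃ b ∈ insert s S, h b = y) → y ≠ h s ∧ ¬ ∃ b ∈ S, h b = y := by
    intro y hy
    refine ⟨fun e => hy ⟨s, Finset.mem_insert_self _ _, e.symm⟩, ?_⟩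
    rintro ⟨b, hb, he⟩
    exact hy ⟨b, Finset.mem_insert_of_mem hb, he⟩
  unfold epsilonAt
  rcases strictMonoOn_or_strictAntiOn hS ha with hm | hm
  -- Increasing case: the new endpoint `s` has `h s` as its own left endpoint, so it is fixed.
  · have hd : defaultPerm h (insert s S) hS' = defaultPerm h S hS := by
      refine Subtype.ext (defaultPerm_eq hS' ?_ ?_)
      · intro b hb
        rcases Finset.mem_insert.1 hb with rfl | hb
        · rw [defaultPerm_apply_of_notMem h S hS hhs]
          refine (leftEnd_eq ?_).symm
          rw [cell_insert_self hs]
          exact isGLB_image_Ioi_of_strictMonoOn hm hs hc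
        · rw [defaultPerm_apply h S hS hb]
          by_cases hba : b = a
          · subst hba
            refine (leftEnd_eq ?_).symm
            rw [cell_insert_left hs]
            exact isGLB_image_Iio_of_strictMonoOn hm hs (isGLB_leftEnd h S b)
          · exact (leftEnd_insert_of_ne ha hs hb hba).symm
      · intro y hy
        exact defaultPerm_apply_of_notMem h S hS (hnot y hy).2
    rw [hd, flipNumber_insert_of_strictMonoOn ha hs hm]
  · have hne : h a ≠ h s := fun e => hhs ⟨a, ha, e⟩
    -- Decreasing case: `h s` now goes to the old left endpoint of the image, and `h a` goes to `h
    -- s`, which the old permutation fixes.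
    have hd : defaultPerm h (insert s S) hS' =
        defaultPerm h S hS * ⟨Equiv.swap (h a) (h s), swap_mem_SFin _ _⟩ := by
      refine Subtype.ext (defaultPerm_eq hS' ?_ ?_)
      · intro b hb
        change (defaultPerm h S hS).1 (Equiv.swap (h a) (h s) (h b)) = _
        rcases Finset.mem_insert.1 hb with rfl | hb
        · rw [Equiv.swap_apply_right, defaultPerm_apply h S hS ha]
          refine (leftEnd_eq ?_).symm
          rw [cell_insert_self hs]
          exact isGLB_image_Ioi_of_strictAntiOn hm hs (isGLB_leftEnd h S a)
        · by_cases hba : b = a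
          · subst hba
            rw [Equiv.swap_apply_left, defaultPerm_apply_of_notMem h S hS hhs]
            refine (leftEnd_eq ?_).symm
            rw [cell_insert_left hs]
            exact isGLB_image_Iio_of_strictAntiOn hm hs hc
          · rw [Equiv.swap_apply_of_ne_of_ne (fun e => hba (h.injective e))
              (fun e => hhs ⟨b, hb, e⟩), defaultPerm_apply h S hS hb]
            exact (leftEnd_insert_of_ne ha hs hb hba).symm
      · intro y hy
        obtain ⟨h1, h2⟩ := hnot y hy
        change (defaultPerm h S hS).1 (Equiv.swap (h a) (h s) y) = _
        rw [Equiv.swap_apply_of_ne_of_ne (fun e => h2 ⟨a, ha, e.symm⟩) h1,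
          defaultPerm_apply_of_notMem h S hS h2]
    rw [hd, flipNumber_insert_of_strictAntiOn ha hs hm, epsFin_mul, epsFin_swap hne]
    have h2 : (1 : ZMod 2) + 1 = 0 := by decide
    linear_combination h2

end Insert

/-- The signature does not depend on the associated partition. -/
theorem epsilonAt_eq_of_subset {h : Equiv.Perm X} {S T : Finset X} (hS : IsAssociated h S)
    (hST : S ⊆ T) : epsilonAt h T (hS.mono hST) = epsilonAt h S hS := by
  classical
  -- Points of `U` are added to `S` one at a time; the union with `S` keeps every intermediate set
  -- associated.
  have key : ∀ U : Finset X, ∀ hU : IsAssociated h (U ∪ S),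
      epsilonAt h (U ∪ S) hU = epsilonAt h S hS := by
    intro U
    induction U using Finset.induction_on with
    | empty => intro hU; simp only [Finset.empty_union]
    | insert s U _ ih =>
      simp only [Finset.insert_union]
      intro hU
      rw [epsilonAt_insert (hS.mono Finset.subset_union_right), ih]
  have := key T (hS.mono Finset.subset_union_right)
  simp only [Finset.union_eq_left.2 hST] at this
  exact this

theorem epsilon_eq_epsilonAt (h : PCHat) {S : Finset X} (hS : IsAssociated h.1 S) :
    epsilon h = epsilonAt h.1 S hS :=
  (epsilonAt_eq_of_subset (minPartition_isAssociated h) (minPartition_subset h hS)).symm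

/-! ### Composition -/

section Comp

variable {g h : Equiv.Perm X} {S T : Finset X}

/-- The images under `h` of the cells of an associated partition are the cells of the
partition with set of endpoints `h(S)`. -/
theorem image_cell (hS : IsAssociated h S) (hT : ∀ y, y ∈ T ↔ ∃ a ∈ S, h a = y) {a : X}
    (ha : a ∈ S) : h '' cell S a = cell T (leftEnd h S a) := by
  have hsub : ∀ {a : X}, a ∈ S → h '' cell S a ⊆ cell T (leftEnd h S a) := by
    rintro a ha _ ⟨x, hx, rfl⟩
    have hxi : (h x).1 ∈ imageCell h S a := ⟨_, ⟨x, hx, rfl⟩, rfl⟩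
    refine ⟨leftEnd_lt hS ha hxi, fun t ht hlt => ?_⟩
    -- An endpoint `h b` at or below `h x` and above the infimum would lie in the image interval,
    -- putting `b ∈ S` inside a cell.
    by_contra hn
    obtain ⟨b, hb, rfl⟩ := (hT t).1 ht
    obtain ⟨w, hw, hwt⟩ := exists_lt_of_csInf_lt (imageCell_nonempty h S a)
      (show sInf (imageCell h S a) < (h b).1 from hlt)
    obtain ⟨_, ⟨z, hz, rfl⟩, he⟩ := (imageCell_ordConnected hS ha).out hw hxi
      ⟨hwt.le, (not_lt.1 hn : (h b).1 ≤ (h x).1)⟩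
    have : z = b := h.injective (Subtype.ext he)
    exact notMem_of_mem_cell hz (this ▸ hb)
  have hmem : ∀ {a : X}, a ∈ S → leftEnd h S a ∈ T := fun ha =>
    (hT _).2 (leftEnd_mem hS ha)
  refine (hsub ha).antisymm fun y hy => ?_
  -- For the reverse inclusion, `y` comes from some cell of `S`, say that of `b`; disjointness of
  -- the cells of `T` forces `b = a`.
  have hyS : h.symm y ∉ S := fun hyS => notMem_of_mem_cell hy ((hT y).2 ⟨_, hyS, by simp⟩)
  obtain ⟨b, hb, hyb⟩ := exists_mem_cell hS.zero_mem hyS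
  have hyb' : y ∈ h '' cell S b := ⟨_, hyb, by simp⟩
  have := leftEnd_inj hS ha hb (cell_disjoint (hmem ha) (hmem hb) hy (hsub hb hyb'))
  rwa [this]

theorem epsilonAt_mul (hS : IsAssociated h S) (hT : ∀ y, y ∈ T ↔ ∃ a ∈ S, h a = y)
    (hg : IsAssociated g T) (hgh : IsAssociated (g * h) S) :
    epsilonAt (g * h) S hgh = epsilonAt g T hg + epsilonAt h S hS := by
  classical
  have himg : ∀ a, (g * h : Equiv.Perm X) '' cell S a = g '' (h '' cell S a) :=
    fun a => image_comp g h _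
  have hleft : ∀ a ∈ S, leftEnd (g * h) S a = leftEnd g T (leftEnd h S a) := by
    intro a ha
    refine leftEnd_eq ?_
    rw [himg, image_cell hS hT ha]
    exact isGLB_leftEnd _ _ _
  have hmem : ∀ a ∈ S, leftEnd h S a ∈ T := fun a ha => (hT _).2 (leftEnd_mem hS ha)
  -- The cocycle identity: `g (h a)` goes back to `h a`, on to the left endpoint of the image under
  -- `h`, then through `g` and the default permutation of `g`.
  have hd : (defaultPerm (g * h) S hgh).1 =
      (defaultPerm g T hg).1 * (g * (defaultPerm h S hS).1 * g⁻¹) := by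
    refine defaultPerm_eq hgh ?_ ?_
    · intro a ha
      simp only [Equiv.Perm.mul_apply]
      rw [show g⁻¹ (g (h a)) = h a from g.symm_apply_apply _]
      rw [defaultPerm_apply h S hS ha, defaultPerm_apply g T hg (hmem a ha), hleft a ha]
    · intro y hy
      have h1 : ¬ ∃ b ∈ S, h b = g⁻¹ y := by
        rintro ⟨b, hb, he⟩
        exact hy ⟨b, hb, by rw [Equiv.Perm.mul_apply, he]; exact g.apply_symm_apply y⟩
      simp only [Equiv.Perm.mul_apply]
      rw [defaultPerm_apply_of_notMem h S hS h1, show g (g⁻¹ y) = y from g.apply_symm_apply y]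
      refine defaultPerm_apply_of_notMem g T hg ?_
      rintro ⟨t, ht, rfl⟩
      obtain ⟨b, hb, rfl⟩ := (hT t).1 ht
      exact hy ⟨b, hb, rfl⟩
  have hconj : g * (defaultPerm h S hS).1 * g⁻¹ ∈ SFin X :=
    SFin_normal.conj_mem _ (defaultPerm h S hS).2 g
  have hd' : defaultPerm (g * h) S hgh = defaultPerm g T hg * ⟨_, hconj⟩ := Subtype.ext hd
  have heps : epsFin (⟨_, hconj⟩ : SFin X) = epsFin (defaultPerm h S hS) := by
    unfold epsFin
    rw [finSign_congr g (σ := defaultPerm h S hS) (τ := ⟨_, hconj⟩) rfl]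
  -- The map `a ↦ leftEnd h S a` is a bijection from `S` to `T`, so the flips of `g` can be counted
  -- over `S`.
  have hsum : (flipNumber g T : ZMod 2) =
      ∑ a ∈ S, if StrictAntiOn g (cell T (leftEnd h S a)) then 1 else 0 := by
    rw [flipNumber_eq_sum]
    symm
    refine Finset.sum_bij (fun a _ => leftEnd h S a) hmem
      (fun a ha b hb hab => leftEnd_inj hS ha hb hab) ?_ (fun _ _ => rfl)
    intro t ht
    obtain ⟨b, hb, rfl⟩ := (hT t).1 ht
    obtain ⟨⟨_, c, hc, rfl⟩, hce⟩ := (defaultMap_bijective h S hS).2 ⟨h b, b, hb, rfl⟩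
    refine ⟨c, hc, ?_⟩
    simpa [defaultMap] using congrArg Subtype.val hce
  have hflip : (flipNumber (g * h) S : ZMod 2) = flipNumber g T + flipNumber h S := by
    rw [hsum, flipNumber_eq_sum, flipNumber_eq_sum, ← Finset.sum_add_distrib]
    refine Finset.sum_congr rfl fun a ha => ?_
    have hmaps : MapsTo h (cell S a) (cell T (leftEnd h S a)) := by
      rw [← image_cell hS hT ha]
      exact mapsTo_image _ _
    have h2 : (0 : ZMod 2) = 1 + 1 := by decide
    rcases strictMonoOn_or_strictAntiOn hS ha with hm | hm <;>
      rcases strictMonoOn_or_strictAntiOn hg (hmem a ha) with hm' | hm'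
    · have hc : StrictMonoOn (g * h : Equiv.Perm X) (cell S a) := hm'.comp hm hmaps
      rw [if_neg (not_strictAntiOn_of_strictMonoOn hc),
        if_neg (not_strictAntiOn_of_strictMonoOn hm'), if_neg (not_strictAntiOn_of_strictMonoOn hm),
        add_zero]
    · have hc : StrictAntiOn (g * h : Equiv.Perm X) (cell S a) :=
        hm'.comp_strictMonoOn hm hmaps
      rw [if_pos hc, if_pos hm', if_neg (not_strictAntiOn_of_strictMonoOn hm), add_zero]
    · have hc : StrictAntiOn (g * h : Equiv.Perm X) (cell S a) :=
        hm'.comp_strictAntiOn hm hmaps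
      rw [if_pos hc, if_neg (not_strictAntiOn_of_strictMonoOn hm'), if_pos hm, zero_add]
    · have hc : StrictMonoOn (g * h : Equiv.Perm X) (cell S a) := hm'.comp hm hmaps
      rw [if_neg (not_strictAntiOn_of_strictMonoOn hc), if_pos hm, if_pos hm', h2]
  unfold epsilonAt
  rw [hd', epsFin_mul, heps, hflip]
  ring

end Comp

theorem epsilon_mul (g h : PCHat) : epsilon (g * h) = epsilon g + epsilon h := by
  classical
  -- The preimages under `h` are included so that `h(S)` contains every endpoint of the minimal
  -- partition of `g`, in particular `0`.
  let S : Finset X := minPartition h ∪ (minPartition g).image h.1.symm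
  let T : Finset X := S.image h.1
  have hT : ∀ y, y ∈ T ↔ ∃ a ∈ S, h.1 a = y := fun y => Finset.mem_image
  have hS : IsAssociated h.1 S := (minPartition_isAssociated h).mono Finset.subset_union_left
  have hgT : minPartition g ⊆ T := fun y hy => (hT y).2 ⟨h.1.symm y,
    Finset.mem_union_right _ (Finset.mem_image_of_mem _ hy), by simp⟩
  have hg : IsAssociated g.1 T := (minPartition_isAssociated g).mono hgT
  have hgh : IsAssociated (g.1 * h.1) S := by
    refine isAssociated_iff.2 ⟨hS.zero_mem, fun x hx => ?_⟩
    refine ContinuousAt.comp (g := g.1) (f := h.1) ((isAssociated_iff.1 hg).2 _ ?_)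
      ((isAssociated_iff.1 hS).2 x hx)
    intro hxT
    obtain ⟨a, ha, he⟩ := (hT _).1 hxT
    exact hx (h.1.injective he ▸ ha)
  rw [epsilon_eq_epsilonAt (g * h) hgh, epsilon_eq_epsilonAt g hg, epsilon_eq_epsilonAt h hS]
  exact epsilonAt_mul hS hT hg hgh

/-- The signature as a group homomorphism. -/
def epsilonHom : PCHat →* Multiplicative (ZMod 2) :=
  MonoidHom.mk' (fun h => Multiplicative.ofAdd (epsilon h)) fun g h => by
    rw [epsilon_mul, ofAdd_add]

/-! ### Restriction of the signature to finitely supported permutations -/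

theorem epsFin_inv {α : Type*} (σ : SFin α) : epsFin σ⁻¹ = epsFin σ := by
  unfold epsFin
  rw [map_inv, Int.units_inv_eq_self]

theorem isGLB_cell (S : Finset X) (a : X) : IsGLB (cell S a) a := by
  refine ⟨fun x hx => hx.1.le, fun c hc => ?_⟩
  by_contra hn
  obtain ⟨x, hx⟩ := cell_nonempty S a
  obtain ⟨y, hy, hyx⟩ := exists_between (lt_min (not_le.1 hn) hx.1)
  have hyS : y ∈ cell S a :=
    ⟨hy, fun s hs has => (hyx.trans_le (min_le_right _ _)).trans (hx.2 s hs has)⟩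
  exact (hc hyS).not_gt (hyx.trans_le (min_le_left _ _))

/-- The signature extends the classical signature of finitely supported permutations. -/
theorem epsilon_of_mem_SFin (h : PCHat) (hh : h.1 ∈ SFin X) : epsilon h = epsFin ⟨h.1, hh⟩ := by
  classical
  have hfin : {x | h.1 x ≠ x}.Finite := hh
  let S : Finset X := minPartition h ∪ hfin.toFinset
  have hS : IsAssociated h.1 S := (minPartition_isAssociated h).mono Finset.subset_union_left
  have hfix : ∀ x ∉ S, h.1 x = x := by
    intro x hx
    by_contra hn
    exact hx (Finset.mem_union_right _ (hfin.mem_toFinset.2 hn))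
  have hcell : ∀ a, ∀ x ∈ cell S a, h.1 x = x := fun a x hx => hfix x (notMem_of_mem_cell hx)
  have hleft : ∀ a, leftEnd h.1 S a = a := fun a => leftEnd_eq (by
    rw [(EqOn.image_eq (f₂ := id) (hcell a)), image_id]
    exact isGLB_cell S a)
  -- Each cell is fixed pointwise, so its image has left endpoint `b` and `h b` is sent back to `b`.
  -- This gives the inverse of `h`, which has the same signature.
  have hd : defaultPerm h.1 S hS = (⟨h.1, hh⟩ : SFin X)⁻¹ := by
    refine Subtype.ext (defaultPerm_eq hS ?_ ?_)
    · intro b _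
      rw [hleft]
      exact h.1.symm_apply_apply b
    · intro y hy
      have hyS : y ∉ S := by
        intro hyS
        refine hy ⟨h.1.symm y, ?_, by simp⟩
        by_contra hn
        have := hfix _ hn
        rw [Equiv.apply_symm_apply] at this
        exact hn (this ▸ hyS)
      exact (Equiv.symm_apply_eq h.1).2 (hfix y hyS).symm
  have hflip : (flipNumber h.1 S : ZMod 2) = 0 := by
    rw [flipNumber_eq_sum]
    refine Finset.sum_eq_zero fun a _ => if_neg (not_strictAntiOn_of_strictMonoOn ?_)
    intro x hx y hy hxy
    rwa [hcell a x hx, hcell a y hy]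
  rw [epsilon_eq_epsilonAt h hS]
  unfold epsilonAt
  rw [hflip, hd, epsFin_inv, zero_add]

theorem epsilonHom_eq_one_iff_of_mem_SFinPC {h : PCHat} (hh : h ∈ SFinPC) :
    epsilonHom h = 1 ↔ h ∈ AFinPC := by
  have hh' : h.1 ∈ SFin X := hh
  change epsilon h = 0 ↔ h.1 ∈ AFin X
  rw [epsilon_of_mem_SFin h hh', epsFin_eq_zero_iff_mem]

open scoped commutatorElement

/-! ### The alternating group and three-cycles -/

/-- Even finitely supported permutations are products of elements of order `3` which are
conjugate to their inverses by finitely supported permutations. -/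
theorem AFin_le_closure (α : Type*) :
    AFin α ≤ Subgroup.closure {τ | τ ∈ SFin α ∧ orderOf τ = 3 ∧ ∃ ρ ∈ SFin α, ρ * τ * ρ⁻¹ = τ⁻¹} := by
  classical
  rintro _ ⟨σ, hσ, rfl⟩
  let _ : Fintype {x // σ.1 x ≠ x} := Set.Finite.fintype σ.2
  have hsign : Equiv.Perm.sign (restrictSupport σ.1) = 1 := by
    have h : finSignFun σ = 1 := hσ
    unfold finSignFun at h
    convert h
  let f : Equiv.Perm {x // σ.1 x ≠ x} →* Equiv.Perm α := Equiv.Perm.ofSubtype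
  have hf : Function.Injective f := Equiv.Perm.ofSubtype_injective
  have hfin : ∀ c, f c ∈ SFin α := fun c => by
    refine Set.Finite.subset σ.2 fun x hx hn => hx ?_
    exact Equiv.Perm.ofSubtype_apply_of_not_mem _ (not_not.2 hn)
  -- On the finite support, this is the generation of a finite alternating group by three-cycles.
  have hmem : restrictSupport σ.1 ∈ Subgroup.closure
      {c : Equiv.Perm {x // σ.1 x ≠ x} | c.IsThreeCycle} := by
    rw [Equiv.Perm.closure_three_cycles_eq_alternating]
    exact Equiv.Perm.mem_alternatingGroup.2 hsign
  have hσf : f (restrictSupport σ.1) = σ.1 :=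
    Equiv.Perm.ofSubtype_subtypePerm _ fun _ hx => hx
  have hmap : σ.1 ∈ (Subgroup.closure
      {c : Equiv.Perm {x // σ.1 x ≠ x} | c.IsThreeCycle}).map f := ⟨_, hmem, hσf⟩
  rw [MonoidHom.map_closure] at hmap
  refine Subgroup.closure_mono ?_ hmap
  rintro _ ⟨c, hc, rfl⟩
  have hc' : c.IsThreeCycle := hc
  refine ⟨hfin c, (orderOf_injective f hf c).trans hc'.orderOf, ?_⟩
  -- A permutation of a finite set has the same cycle type as its inverse, hence is conjugate to it.
  obtain ⟨ρ, hρ⟩ := isConj_iff.1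
    (Equiv.Perm.isConj_iff_cycleType_eq.2 (Equiv.Perm.cycleType_inv c).symm)
  exact ⟨f ρ, hfin ρ, by rw [← map_inv f, ← map_mul, ← map_mul, hρ, map_inv]⟩

/-! ### Subgroups with simple quotient -/

/-- The image of `K` is normal and nontrivial, hence everything. An element of `φ.ker` thus differs
from an element of `K` by something in both kernels, which is again in `K`. -/
theorem eq_ker_of_isSimpleGroup {Γ Q A : Type*} [Group Γ] [Group Q] [Group A] [IsSimpleGroup Q]
    {p : Γ →* Q} (hp : Function.Surjective p) {φ : Γ →* A} {K : Subgroup Γ} (hK : K.Normal)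
    (hKφ : K ≤ φ.ker) (hpφ : p.ker ⊓ φ.ker ≤ K) (hne : ∃ k ∈ K, p k ≠ 1) : K = φ.ker := by
  refine le_antisymm hKφ fun g hg => ?_
  have htop : K.map p = ⊤ := by
    refine (IsSimpleGroup.eq_bot_or_eq_top_of_normal _ (hK.map p hp)).resolve_left fun hbot => ?_
    obtain ⟨k, hk, hk1⟩ := hne
    exact hk1 (Subgroup.mem_bot.1 (hbot ▸ Subgroup.mem_map_of_mem p hk))
  obtain ⟨k, hk, hkg⟩ : p g ∈ K.map p := htop ▸ Subgroup.mem_top _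
  have hmem : k⁻¹ * g ∈ p.ker := by rw [MonoidHom.mem_ker, map_mul, map_inv, hkg, inv_mul_cancel]
  have : k⁻¹ * g ∈ K := hpφ ⟨hmem, φ.ker.mul_mem (φ.ker.inv_mem (hKφ hk)) hg⟩
  simpa using mul_mem hk this

/-- Conjugation preserves the order of an element. -/
theorem J3_normal (H : Type*) [Group H] : (J3 H).Normal := by
  have : J3 H = Subgroup.normalClosure {g : H | orderOf g = 3} := by
    refine le_antisymm Subgroup.closure_le_normalClosure ?_
    refine (Subgroup.closure_le _).2 fun x hx => Subgroup.subset_closure ?_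
    obtain ⟨g, hg, hgx⟩ := Group.mem_conjugatesOfSet_iff.1 hx
    obtain ⟨c, rfl⟩ := isConj_iff.1 hgx
    exact (orderOf_injective (MulAut.conj c).toMonoidHom (MulAut.conj c).injective g).trans hg
  rw [this]
  infer_instance

theorem map_eq_one_of_orderOf_eq_three {H : Type*} [Group H] (φ : H →* Multiplicative (ZMod 2))
    {g : H} (hg : orderOf g = 3) : φ g = 1 := by
  have h3 : φ g ^ 3 = 1 := by rw [← map_pow, ← hg, pow_orderOf_eq_one, map_one]
  have key : ∀ x : Multiplicative (ZMod 2), x ^ 3 = 1 → x = 1 := by decide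
  exact key _ h3

/-- The commutator of `ρ` and `c` is `c⁻¹ * c⁻¹`, which equals `c` because `c ^ 3 = 1`. -/
theorem mem_commutator_of_conj_eq_inv {H : Type*} [Group H] {c ρ : H} (hc : orderOf c = 3)
    (h : ρ * c * ρ⁻¹ = c⁻¹) : c ∈ commutator H := by
  have h3 : c ^ 3 = 1 := hc ▸ pow_orderOf_eq_one c
  have hcomm : c = ⁅ρ, c⁆ := by
    rw [commutatorElement_def, h, eq_mul_inv_iff_mul_eq, eq_inv_iff_mul_eq_one, ← h3,
      pow_succ, pow_two]
  rw [hcomm]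
  exact Subgroup.commutator_mem_commutator (Subgroup.mem_top _) (Subgroup.mem_top _)

theorem exists_mem_commutator_map_ne_one {Γ Q : Type*} [Group Γ] [Group Q] {p : Γ →* Q}
    (hp : Function.Surjective p) (h : ∃ a b : Q, a * b ≠ b * a) :
    ∃ k ∈ commutator Γ, p k ≠ 1 := by
  obtain ⟨a, b, hab⟩ := h
  obtain ⟨a, rfl⟩ := hp a
  obtain ⟨b, rfl⟩ := hp b
  refine ⟨⁅a, b⁆,
    Subgroup.commutator_mem_commutator (Subgroup.mem_top _) (Subgroup.mem_top _), fun h1 => ?_⟩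
  rw [map_commutatorElement, commutatorElement_eq_one_iff_mul_comm] at h1
  exact hab h1

/-! ### Comparison of subgroups with the kernel of the signature -/

section Main

variable {Ghat : Subgroup PCHat}

/-- The hypothesis `hK` is weak enough for both applications: order 3 puts `τ` in `J3`, and being
conjugate to its inverse makes it a commutator. The conjugators are finitely supported, hence
available in `Ghat`. -/
theorem mem_of_mem_AFinPC (hS : SFinPC ≤ Ghat) {K : Subgroup Ghat}
    (hK : ∀ τ ρ : Ghat, orderOf τ = 3 → ρ * τ * ρ⁻¹ = τ⁻¹ → τ ∈ K) {x : Ghat}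
    (hx : x.1 ∈ AFinPC) : x ∈ K := by
  let ι : Ghat →* Equiv.Perm X := PCHat.subtype.comp Ghat.subtype
  have hι : Function.Injective ι := Subtype.val_injective.comp Subtype.val_injective
  have hlift : ∀ τ ∈ SFin X, ∃ t : Ghat, ι t = τ := fun τ hτ =>
    ⟨⟨⟨τ, SFin_le_PCHat hτ⟩, hS hτ⟩, rfl⟩
  have hle : AFin X ≤ K.map ι := by
    refine (AFin_le_closure X).trans ((Subgroup.closure_le _).2 ?_)
    rintro τ ⟨hτ, h3, ρ, hρ, hconj⟩
    obtain ⟨t, rfl⟩ := hlift τ hτ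
    obtain ⟨r, rfl⟩ := hlift ρ hρ
    refine ⟨t, hK t r ((orderOf_injective ι hι t).symm.trans h3) (hι ?_), rfl⟩
    simpa only [map_mul, map_inv] using hconj
  obtain ⟨k, hk, hkx⟩ := hle (show ι x ∈ AFin X from hx)
  exact hι hkx ▸ hk

theorem ker_subgroupMap_iff (x : Ghat) :
    (QuotientGroup.mk' SFinPC).subgroupMap Ghat x = 1 ↔ x.1 ∈ SFinPC := by
  rw [Subtype.ext_iff]
  exact QuotientGroup.eq_one_iff (N := SFinPC) x.1

theorem eq_ker_epsilonHom (hS : SFinPC ≤ Ghat)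
    [IsSimpleGroup (Ghat.map (QuotientGroup.mk' SFinPC) : Subgroup PC)]
    {K : Subgroup Ghat} (hn : K.Normal) (hle : K ≤ (epsilonHom.comp Ghat.subtype).ker)
    (hK : ∀ τ ρ : Ghat, orderOf τ = 3 → ρ * τ * ρ⁻¹ = τ⁻¹ → τ ∈ K)
    (hne : ∃ k ∈ K, (QuotientGroup.mk' SFinPC).subgroupMap Ghat k ≠ 1) :
    K = (epsilonHom.comp Ghat.subtype).ker := by
  refine eq_ker_of_isSimpleGroup (MonoidHom.subgroupMap_surjective _ _) hn hle ?_ hne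
  rintro x ⟨hx1, hx2⟩
  have hxS : x.1 ∈ SFinPC := (ker_subgroupMap_iff x).1 hx1
  exact mem_of_mem_AFinPC hS hK ((epsilonHom_eq_one_iff_of_mem_SFinPC hxS).1 hx2)

end Main

end PCSig

end

theorem mainTheorem6 (Ghat : Subgroup PCSig.PCHat) (hS : PCSig.SFinPC ≤ Ghat)
    (hsimple : IsSimpleGroup (Ghat.map (QuotientGroup.mk' PCSig.SFinPC) : Subgroup PCSig.PC))
    (hnonab : ∃ a b : (Ghat.map (QuotientGroup.mk' PCSig.SFinPC) : Subgroup PCSig.PC),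
      a * b ≠ b * a)
    (h3 : ∃ g ∈ Ghat, g ∉ PCSig.AFinPC ∧ orderOf g = 3) :
    ∃ ε : PCSig.PCHat →* Multiplicative (ZMod 2),
      (∀ h, ε h = Multiplicative.ofAdd (PCSig.epsilon h)) ∧
      PCSig.J3 Ghat = (ε.comp Ghat.subtype).ker ∧
      (ε.comp Ghat.subtype).ker = commutator Ghat := by
  refine ⟨PCSig.epsilonHom, fun _ => rfl, ?_, ?_⟩
  · refine PCSig.eq_ker_epsilonHom hS (PCSig.J3_normal _) ?_
      (fun τ _ hτ _ => Subgroup.subset_closure hτ) ?_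
    · exact (Subgroup.closure_le _).2 fun g hg => PCSig.map_eq_one_of_orderOf_eq_three _ hg
    · obtain ⟨g, hg, hgA, hg3⟩ := h3
      -- An element of order 3 has trivial signature; if it died in the quotient it would be
      -- finitely supported and even, contrary to `hgA`.
      refine ⟨⟨g, hg⟩, Subgroup.subset_closure ?_, fun h1 => hgA ?_⟩
      · exact (Subgroup.orderOf_mk g hg).trans hg3
      · exact (PCSig.epsilonHom_eq_one_iff_of_mem_SFinPC ((PCSig.ker_subgroupMap_iff _).1 h1)).1
          (PCSig.map_eq_one_of_orderOf_eq_three _ hg3)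
  · symm
    refine PCSig.eq_ker_epsilonHom hS inferInstance (Abelianization.commutator_subset_ker _) ?_ ?_
    · intro τ ρ hτ hρ
      exact PCSig.mem_commutator_of_conj_eq_inv hτ hρ
    · exact PCSig.exists_mem_commutator_map_ne_one (MonoidHom.subgroupMap_surjective _ _) hnonab
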